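/- **Setting.** An instance $I$ consists of a finite set $N$ of $n$ agents, a set $\mathcal V$ of $n$ plots, an undirected plot graph $(\mathcal V,\mathcal E)$, plot values $u_i(v)\in\{0,1\}$ ($i\in N$, $v\in\mathcal V$; the instance is *binary*), and a reciprocal friendship relation $F$ on $N$ in which every agent has at most one friend. All friendships have the same weight $\phi>1$ (if $F=\varnothing$, $\phi>1$ is any number). An allocation is a bijection $A:N\to\mathcal V$. The utility of $i$ is $U_i(A)=u_i(A(i))+\phi\cdot|\{j:(i,j)\in F,\ \{A(i),A(j)\}\in\mathcal E\}|$, and $\mathrm{SW}(A)=\sum_{i\in N}U_i(A)$, $\mathrm{OPT}(I)=\max_A \mathrm{SW}(A)$. **Mechanism On-CA-RSD\*.** While agents remain, one remaining agent is drawn uniformly at random, where friendless agents who value all available plots at $0$ are pushed to the back of the queue: they are drawn only when no other agents remain. The drawn agent $i$ picks an available plot $v$. If the friend $j$ of $i$ has not picked yet and some available plot is adjacent to $v$, then $i$ declares $j$, and $j$ must immediately pick an available plot adjacent to $v$. If $j$ has not picked yet but no available plot is adjacent to $v$, then $i$ may or may not declare $j$; if she does, $j$ immediately picks any available plot. Agents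 report friendships truthfully, and every agent picks a plot that maximizes, over the plots she may choose from, the utility she secures: her value for the plot, plus $\phi$ if she has a friend who either already holds an adjacent plot, or has not picked yet while some available plot is adjacent to the one she picks. Ties between best plots are broken arbitrarily, possibly at random and depending on the history (and so is the decision whether to declare a friend after picking a plot without available adjacent plots), with one exception: an agent who has a friend and who secures utility $0$ from every available plot picks one of these plots uniformly at random. **Theorem 5.2.** Let $A$ be the random allocation that On-CA-RSD\* outputs on a binary instance $I$ as above, with $\phi>1$. Then $$\mathbb E[\mathrm{SW}(A)]\ \ge\ \frac{1}{2\phi+2}\,\mathrm{OPT}(I).$$ -/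

import Mathlib

/-- A land allocation instance with agents `N` and equally many plots `V`: an undirected plot graph,
reciprocal friendships (a simple graph on the agents), plot values in `[0, 1]`, and the
non-negative utility `weight i j` that `i` derives from living next to her friend `j`
(`weight i j` is irrelevant if `i` and `j` are not friends). -/
structure LandInstance (N V : Type*) [Fintype N] [Fintype V] where
  card_eq : Fintype.card N = Fintype.card V
  plots : SimpleGraph V
  friends : SimpleGraph N
  value : N → V → ℝ
  value_mem : ∀ i v, value i v ∈ Set.Icc (0 : ℝ) 1
  weight : N → N → ℝ
  weight_nonneg : ∀ i j, friends.Adj i j → 0 ≤ weight i j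

namespace LandInstance

variable {N V : Type*} [Fintype N] [Fintype V]

/-- Every plot value is `0` or `1`. -/
def IsBinary (I : LandInstance N V) : Prop :=
  ∀ i v, I.value i v = 0 ∨ I.value i v = 1

/-- All friendships have the same weight `φ`. -/
def IsFriendshipUniform (I : LandInstance N V) (φ : ℝ) : Prop :=
  ∀ i j, I.friends.Adj i j → I.weight i j = φ

/-- Every agent has at most one friend. -/
def AtMostOneFriend (I : LandInstance N V) : Prop :=
  ∀ i j k, I.friends.Adj i j → I.friends.Adj i k → j = k

open scoped Classical in
/-- The utility of agent `i` under the allocation `A`. -/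
noncomputable def utility (I : LandInstance N V) (A : N ≃ V) (i : N) : ℝ :=
  I.value i (A i) +
    ∑ j with I.friends.Adj i j, I.weight i j * (if I.plots.Adj (A i) (A j) then 1 else 0)

/-- The social welfare of an allocation. -/
noncomputable def socialWelfare (I : LandInstance N V) (A : N ≃ V) : ℝ :=
  ∑ i, I.utility A i

/-- The maximum social welfare of an allocation. -/
noncomputable def opt (I : LandInstance N V) : ℝ :=
  ⨆ A : N ≃ V, I.socialWelfare A

end LandInstance

/-- A state of the mechanism: the agents who have not picked yet, the plots of the agents, and the
picks made so far, in order. Only the plots of the agents outside `remaining` are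
final. The agents in `remaining` hold the available plots as placeholders, which have no meaning
except that they keep `plot` a bijection. -/
structure PickState (N V : Type*) where
  remaining : Finset N
  plot : N ≃ V
  history : List (N × V)

namespace PickState

variable {N V : Type*}

/-- The plots that have not been picked yet. -/
def available (s : PickState N V) : Finset V :=
  s.remaining.map s.plot.toEmbedding

open scoped Classical in
/-- Agent `i` picks the available plot `v`; the agent who held `v` as a placeholder (if not `i`
herself) receives the placeholder of `i` in exchange. -/
noncomputable def assign (s : PickState N V) (i : N) (v : V) : PickState N V where
  remaining := s.remaining.erase i
  plot := s.plot.trans (Equiv.swap (s.plot i) v)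
  history := s.history ++ [(i, v)]

end PickState

/-- How the agents decide where they are indifferent. `choose s i T` is the distribution of the
pick of agent `i` in state `s` if `T` is the set of her best plots. `declares s i v` tells whether
agent `i`, having picked in state `s` a plot `v` without available adjacent plots, still declares
her friend. -/
structure TieBreaking (N V : Type*) where
  choose : PickState N V → N → Finset V → PMF V
  support_choose : ∀ s i (T : Finset V), T.Nonempty → ∀ v ∈ (choose s i T).support, v ∈ T
  declares : PickState N V → N → V → Prop

namespace LandInstance

variable {N V : Type*} [Fintype N] [Fintype V]

/-- Some available plot is adjacent to `v`. -/
def NonSingleton (I : LandInstance N V) (s : PickState N V) (v : V) : Prop :=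
  ∃ w ∈ s.available, I.plots.Adj v w

open scoped Classical in
/-- The utility that agent `i` secures by picking `v` in state `s`: the value of `v`, plus the
weight of a friend who has not picked yet if some available plot is adjacent to `v` (the friend
then has to pick such a plot), plus the weight of a friend who holds a plot adjacent to `v`. -/
noncomputable def pickUtility (I : LandInstance N V) (s : PickState N V) (i : N) (v : V) : ℝ :=
  I.value i v +
    ∑ j with I.friends.Adj i j, I.weight i j *
      (if j ∈ s.remaining then (if I.NonSingleton s v then 1 else 0)
        else (if I.plots.Adj v (s.plot j) then 1 else 0))

open scoped Classical in
/-- The plots in `T` that are best for agent `i` in state `s`. -/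
noncomputable def bestPlots (I : LandInstance N V) (s : PickState N V) (i : N) (T : Finset V) :
    Finset V :=
  T.filter fun v => ∀ w ∈ T, I.pickUtility s i w ≤ I.pickUtility s i v

/-- Agent `i` picks a best plot among those in `T`. -/
noncomputable def pick (I : LandInstance N V) (τ : TieBreaking N V) (s : PickState N V) (i : N)
    (T : Finset V) : PMF (PickState N V) :=
  (τ.choose s i (I.bestPlots s i T)).map (s.assign i)

open scoped Classical in
/-- The turn of agent `i`, who was drawn in state `s`. She picks a plot `v` of her choice. If her
friend has not picked yet, then: if some available plot is adjacent to `v`, she declares her friend,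
who must pick a plot adjacent to `v` right away; otherwise she may or may not declare
her friend, who in the former case picks any available plot right away. (Under `AtMostOneFriend`
the agent `h.choose` is the only friend of `i`.) -/
noncomputable def turn (I : LandInstance N V) (τ : TieBreaking N V) (s : PickState N V) (i : N) :
    PMF (PickState N V) :=
  (τ.choose s i (I.bestPlots s i s.available)).bind fun v =>
    if h : ∃ j ∈ s.remaining, I.friends.Adj i j then
      if I.NonSingleton s v then
        I.pick τ (s.assign i v) h.choose
          ((s.assign i v).available.filter fun w => I.plots.Adj v w)
      else if τ.declares s i v then
        I.pick τ (s.assign i v) h.choose (s.assign i v).available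
      else PMF.pure (s.assign i v)
    else PMF.pure (s.assign i v)

open scoped Classical in
/-- The remaining agents other than the friendless ones who value all available plots at `0`. -/
noncomputable def active (I : LandInstance N V) (s : PickState N V) : Finset N :=
  s.remaining.filter fun i => (∃ j, I.friends.Adj i j) ∨ ∃ v ∈ s.available, I.value i v ≠ 0

open scoped Classical in
/-- The agents among whom the next one is drawn: friendless agents who value all available plots
at `0` have to wait until no other agents remain. -/
noncomputable def drawPool (I : LandInstance N V) (s : PickState N V) : Finset N :=
  if (I.active s).Nonempty then I.active s else s.remaining

open scoped Classical in
/-- One round: an agent is drawn uniformly at random and has her turn. -/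
noncomputable def round (I : LandInstance N V) (τ : TieBreaking N V) (s : PickState N V) :
    PMF (PickState N V) :=
  if h : (I.drawPool s).Nonempty then (PMF.uniformOfFinset (I.drawPool s) h).bind (I.turn τ s)
  else PMF.pure s

/-- The state after `k` rounds that start from `s`. -/
noncomputable def run (I : LandInstance N V) (τ : TieBreaking N V) :
    ℕ → PickState N V → PMF (PickState N V)
  | 0, s => PMF.pure s
  | k + 1, s => (I.round τ s).bind (I.run τ k)

/-- The initial state: no agent has picked, and the placeholders are arbitrary. -/
noncomputable def initialState (I : LandInstance N V) : PickState N V where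
  remaining := Finset.univ
  plot := Fintype.equivOfCardEq I.card_eq
  history := []

/-- The random allocation produced by the mechanism On-CA-RSD*. (In each round at least one
remaining agent picks a plot, so after as many rounds as there are agents all have picked.) -/
noncomputable def onCARSDStar (I : LandInstance N V) (τ : TieBreaking N V) : PMF (N ≃ V) :=
  (I.run τ (Fintype.card N) I.initialState).map PickState.plot

open scoped Classical in
/-- The expected social welfare of a random allocation. -/
noncomputable def expectedWelfare (I : LandInstance N V) (P : PMF (N ≃ V)) : ℝ :=
  ∑ A : N ≃ V, (P A).toReal * I.socialWelfare A

/-- An agent with a friend to whom all available plots are worth `0`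
picks one of them uniformly at random. Otherwise ties are broken arbitrarily. -/
def UnbiasedWhenWorthless (I : LandInstance N V) (τ : TieBreaking N V) : Prop :=
  ∀ (s : PickState N V) (i : N), i ∈ s.remaining → (∃ j, I.friends.Adj i j) →
    (∀ v ∈ s.available, I.pickUtility s i v = 0) →
      ∀ v ∈ s.available, τ.choose s i s.available v = (s.available.card : ENNReal)⁻¹

end LandInstance

/-! The proof is a potential argument. In each state, split welfare into the part `secured` by the
agents who have picked and the `residual` optimum of the remaining agents on the available plots,
and set Φ = (2φ+2)·secured + residual. Initially Φ is the optimum and at the end Φ is (2φ+2) times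
the welfare of the outcome, so it suffices that the expectation of Φ never decreases in a round
(`potential_le_expect_round`).

While two available plots are adjacent, this holds for every outcome
(`potential_le_of_mem_support_turn`). Since φ > 1, an agent with a friend picks a plot with an
available neighbour and the friend follows at once, so no pair is split (`Settled`). A friendless
active agent secures 1 and costs the residual at most her own value plus the value and friendship of
the agent she displaces, 2φ+2 in total. A pair secures at least x + 2φ, where x is the first
picker's value, and costs at most x + 4φ + 4 (`residual_assign_pair`); this suffices because 4φ² ≥
4.

Once no two available plots are adjacent, no new friendship can be realised, and the residual R is
the value of a maximum assignment of m agents. An agent who values some plot secures 1 and her pick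
costs at most 2. A worthless pick by an agent with a friend is uniform, so it destroys R/m on
average; a friend declared by her may act too, for a total of at most 2R/m
(`potential_turn_of_edgeless`). At least R of the at most m active agents value some plot, so over a
uniform draw the gains outweigh these losses. When no active agent is left, R = 0 and nothing can be
lost. -/

namespace PickState

/-! ### Bookkeeping of states and of allocations extending them. -/

variable {N V : Type*} {s : PickState N V} {i a : N} {v w : V}

theorem mem_available : w ∈ s.available ↔ s.plot.symm w ∈ s.remaining := by
  simp only [available, Finset.mem_map_equiv]

theorem plot_mem_available : s.plot a ∈ s.available ↔ a ∈ s.remaining := by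
  simp [mem_available]

theorem available_nonempty (ha : a ∈ s.remaining) : s.available.Nonempty :=
  ⟨_, plot_mem_available.2 ha⟩

theorem card_available : s.available.card = s.remaining.card :=
  Finset.card_map _

@[simp]
theorem assign_plot_self : (s.assign i v).plot i = v := by
  simp [assign]

open scoped Classical in
@[simp]
theorem assign_remaining : (s.assign i v).remaining = s.remaining.erase i := rfl

theorem assign_plot_of_notMem (hi : i ∈ s.remaining) (hv : v ∈ s.available)
    (ha : a ∉ s.remaining) : (s.assign i v).plot a = s.plot a := by
  have ha' := mt plot_mem_available.1 ha
  have h1 : s.plot a ≠ s.plot i := fun h => ha' (h ▸ plot_mem_available.2 hi)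
  have h2 : s.plot a ≠ v := fun h => ha' (h ▸ hv)
  classical
  exact Equiv.swap_apply_of_ne_of_ne h1 h2

theorem mem_assign_available (hi : i ∈ s.remaining) (hv : v ∈ s.available) :
    w ∈ (s.assign i v).available ↔ w ∈ s.available ∧ w ≠ v := by
  classical
  have e : (s.assign i v).plot.symm w = s.plot.symm (Equiv.swap (s.plot i) v w) := by
    simp only [assign, Equiv.symm_trans_apply, Equiv.symm_swap]
  rw [mem_available, e, assign_remaining, Finset.mem_erase]
  rcases eq_or_ne w v with rfl | hwv
  · simp
  rcases eq_or_ne w (s.plot i) with rfl | hwi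
  · simp only [Equiv.swap_apply_left, hwv, ne_eq, not_false_eq_true, and_true]
    rw [plot_mem_available, ← mem_available]
    simp only [hi, hv, and_true, iff_true]
    rintro rfl
    simp at hwv
  · rw [Equiv.swap_apply_of_ne_of_ne hwi hwv, ← mem_available]
    have : s.plot.symm w ≠ i := by
      rintro rfl
      simp at hwi
    tauto

/-- `A` allocates the agents who have picked as the state `s` does. -/
def Agrees (s : PickState N V) (A : N ≃ V) : Prop :=
  ∀ a ∉ s.remaining, A a = s.plot a

namespace Agrees

variable {A : N ≃ V}

theorem mem_available (h : s.Agrees A) : A a ∈ s.available ↔ a ∈ s.remaining := by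
  constructor
  · intro ha
    by_contra hn
    rw [h a hn, plot_mem_available] at ha
    exact hn ha
  · intro ha
    by_contra hn
    rw [PickState.mem_available] at hn
    have := h _ hn
    rw [Equiv.apply_symm_apply] at this
    rw [A.injective this] at hn
    exact hn ha

theorem symm_mem (h : s.Agrees A) (hv : v ∈ s.available) : A.symm v ∈ s.remaining := by
  rwa [← h.mem_available, Equiv.apply_symm_apply]

-- An extension of `s` is repaired after a pick by giving the plot reserved for `i` to the agent for
-- whom `v` was reserved. Both plots were available, so no final plot moves.
open scoped Classical in
theorem assign_swap (h : s.Agrees A) (hi : i ∈ s.remaining) (hv : v ∈ s.available) :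
    (s.assign i v).Agrees (A.trans (Equiv.swap (A i) v)) := by
  intro a ha
  rcases eq_or_ne a i with rfl | hai
  · simp
  have har : a ∉ s.remaining := by
    intro h'
    exact ha (by simp [hai, h'])
  rw [assign_plot_of_notMem hi hv har, Equiv.trans_apply]
  have h1 : A a ≠ A i := fun e => hai (A.injective e)
  have h2 : A a ≠ v := by
    rintro rfl
    exact har (h.mem_available.1 hv)
  rw [Equiv.swap_apply_of_ne_of_ne h1 h2, h a har]

theorem assign (h : s.Agrees A) (hi : i ∈ s.remaining) :
    (s.assign i (A i)).Agrees A := by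
  simpa using h.assign_swap hi (h.mem_available.2 hi)

end Agrees

end PickState

namespace LandInstance

open scoped Classical

/-! ### Welfare generated inside a set of agents. -/

variable {N V : Type*} [Fintype N] [Fintype V] (I : LandInstance N V) (φ : ℝ)

/-- The indicator that `i` and `j` are friends with adjacent plots. -/
noncomputable def bond (A : N ≃ V) (i j : N) : ℝ :=
  if I.friends.Adj i j ∧ I.plots.Adj (A i) (A j) then 1 else 0

/-- The social welfare that the agents in `S` generate among themselves, with friendship
weight `φ`. -/
noncomputable def welfareOn (S : Finset N) (A : N ≃ V) : ℝ :=
  ∑ i ∈ S, I.value i (A i) + φ * ∑ i ∈ S, ∑ j ∈ S, I.bond A i j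

variable {I φ} {S T : Finset N} {A B : N ≃ V} {i j k l : N} {v w : V} {s : PickState N V}

theorem value_nonneg (I : LandInstance N V) (i : N) (v : V) : 0 ≤ I.value i v := (I.value_mem i v).1

theorem value_le_one (I : LandInstance N V) (i : N) (v : V) : I.value i v ≤ 1 := (I.value_mem i v).2

theorem bond_nonneg : 0 ≤ I.bond A i j := by
  unfold bond; split_ifs <;> norm_num

theorem bond_le_one : I.bond A i j ≤ 1 := by
  unfold bond; split_ifs <;> norm_num

theorem bond_comm : I.bond A i j = I.bond A j i := by
  simp only [bond, I.friends.adj_comm i j, I.plots.adj_comm (A i) (A j)]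

@[simp]
theorem bond_self : I.bond A i i = 0 := by
  simp [bond]

/-- The factor 2 appears because each friendship is counted once from either side. -/
theorem welfareOn_insert (hi : i ∉ S) :
    I.welfareOn φ (insert i S) A =
      I.welfareOn φ S A + I.value i (A i) + 2 * φ * ∑ j ∈ S, I.bond A i j := by
  have h : ∑ x ∈ S, I.bond A x i = ∑ x ∈ S, I.bond A i x :=
    Finset.sum_congr rfl fun x _ => bond_comm
  simp only [welfareOn, Finset.sum_insert hi, bond_self, Finset.sum_add_distrib, h]
  ring

theorem welfareOn_erase (hi : i ∈ S) :
    I.welfareOn φ S A = I.welfareOn φ (S.erase i) A + I.value i (A i) +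
      2 * φ * ∑ j ∈ S.erase i, I.bond A i j := by
  rw [← welfareOn_insert (Finset.notMem_erase i S), Finset.insert_erase hi]

theorem welfareOn_congr (h : ∀ a ∈ S, A a = B a) : I.welfareOn φ S A = I.welfareOn φ S B := by
  unfold welfareOn bond
  congr 1
  · exact Finset.sum_congr rfl fun a ha => by rw [h a ha]
  · congr 1
    exact Finset.sum_congr rfl fun a ha => Finset.sum_congr rfl fun b hb => by rw [h a ha, h b hb]

theorem welfareOn_nonneg (hφ : 0 ≤ φ) : 0 ≤ I.welfareOn φ S A :=
  add_nonneg (Finset.sum_nonneg fun _ _ => I.value_nonneg _ _)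
    (mul_nonneg hφ (Finset.sum_nonneg fun _ _ => Finset.sum_nonneg fun _ _ => bond_nonneg))

theorem sum_bond_nonneg : 0 ≤ ∑ j ∈ S, I.bond A i j := Finset.sum_nonneg fun _ _ => bond_nonneg

theorem sum_bond_eq_of_adj (hf : I.AtMostOneFriend) (h : I.friends.Adj i j) (hj : j ∈ S) :
    ∑ k ∈ S, I.bond A i k = I.bond A i j := by
  refine Finset.sum_eq_single_of_mem j hj fun k _ hk => ?_
  exact if_neg fun h' => hk (hf i k j h'.1 h)

theorem sum_bond_eq_zero (h : ∀ j ∈ S, ¬ I.friends.Adj i j) : ∑ k ∈ S, I.bond A i k = 0 :=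
  Finset.sum_eq_zero fun k hk => if_neg fun h' => h k hk h'.1

theorem sum_bond_eq_zero_of_adj (hf : I.AtMostOneFriend) (h : I.friends.Adj i j) (hj : j ∉ S) :
    ∑ k ∈ S, I.bond A i k = 0 :=
  sum_bond_eq_zero fun k hk h' => hj (hf i j k h h' ▸ hk)

theorem sum_bond_le_one (hf : I.AtMostOneFriend) : ∑ k ∈ S, I.bond A i k ≤ 1 := by
  by_cases h : ∃ j ∈ S, I.friends.Adj i j
  · obtain ⟨j, hj, h⟩ := h
    rw [sum_bond_eq_of_adj hf h hj]
    exact bond_le_one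
  · push Not at h
    rw [sum_bond_eq_zero h]
    norm_num

theorem welfareOn_le_insert (hφ : 0 ≤ φ) (hi : i ∉ S) :
    I.welfareOn φ S A + I.value i (A i) ≤ I.welfareOn φ (insert i S) A := by
  rw [welfareOn_insert hi]
  have := mul_nonneg (mul_nonneg zero_le_two hφ) (sum_bond_nonneg (I := I) (S := S) (A := A) (i := i))
  linarith

/-- Moving the single agent `k` costs at most her value and her friendship. -/
theorem welfareOn_move (hφ : 0 ≤ φ) (hk : k ∈ S) (h : ∀ a ∈ S, a ≠ k → B a = A a) :
    I.welfareOn φ S A ≤ I.welfareOn φ S B + I.value k (A k) +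
      2 * φ * ∑ j ∈ S, I.bond A k j := by
  have h1 := welfareOn_erase (I := I) (φ := φ) (A := A) hk
  have h2 := welfareOn_le_insert (I := I) (A := B) hφ (Finset.notMem_erase k S)
  rw [Finset.insert_erase hk] at h2
  have h3 : I.welfareOn φ (S.erase k) A = I.welfareOn φ (S.erase k) B :=
    welfareOn_congr fun a ha => (h a (Finset.mem_of_mem_erase ha) (Finset.ne_of_mem_erase ha)).symm
  have h4 : ∑ j ∈ S.erase k, I.bond A k j = ∑ j ∈ S, I.bond A k j :=
    Finset.sum_erase _ bond_self
  rw [h4] at h1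
  linarith [I.value_nonneg k (B k)]

theorem socialWelfare_eq (hu : I.IsFriendshipUniform φ) :
    I.socialWelfare A = I.welfareOn φ Finset.univ A := by
  unfold socialWelfare utility welfareOn
  rw [Finset.sum_add_distrib, Finset.mul_sum]
  congr 1
  refine Finset.sum_congr rfl fun i _ => ?_
  rw [Finset.mul_sum, Finset.sum_filter]
  refine Finset.sum_congr rfl fun j _ => ?_
  unfold bond
  by_cases h : I.friends.Adj i j
  · simp [h, hu i j h]
  · simp [h]

/-! ### Secured and residual welfare, and the residual cost of picks. -/

variable (I φ)

/-- The welfare that the agents who have picked generate among themselves. -/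
noncomputable def secured (s : PickState N V) : ℝ := I.welfareOn φ s.remainingᶜ s.plot

/-- The maximum welfare that the remaining agents can generate among themselves. -/
noncomputable def residual (s : PickState N V) : ℝ :=
  ⨆ A : {A : N ≃ V // s.Agrees A}, I.welfareOn φ s.remaining A

variable {I φ}

theorem le_residual (h : s.Agrees A) : I.welfareOn φ s.remaining A ≤ I.residual φ s :=
  le_ciSup (f := fun A : {A : N ≃ V // s.Agrees A} => I.welfareOn φ s.remaining A)
    (Set.finite_range _).bddAbove ⟨A, h⟩

variable (I φ) in
theorem exists_residual (s : PickState N V) :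
    ∃ A, s.Agrees A ∧ I.welfareOn φ s.remaining A = I.residual φ s := by
  have : Nonempty {A : N ≃ V // s.Agrees A} := ⟨⟨s.plot, fun _ _ => rfl⟩⟩
  obtain ⟨A, hA⟩ := exists_eq_ciSup_of_finite
    (f := fun A : {A : N ≃ V // s.Agrees A} => I.welfareOn φ s.remaining A)
  exact ⟨A.1, A.2, hA⟩

theorem residual_nonneg (hφ : 0 ≤ φ) : 0 ≤ I.residual φ s := by
  obtain ⟨A, -, hA⟩ := I.exists_residual φ s
  exact hA ▸ welfareOn_nonneg hφ

theorem secured_assign_eq (hi : i ∈ s.remaining) (hv : v ∈ s.available) :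
    I.secured φ (s.assign i v) = I.secured φ s + I.value i v +
      2 * φ * ∑ j ∈ s.remainingᶜ, I.bond (s.assign i v).plot i j := by
  have hi' : i ∉ s.remainingᶜ := by simpa using hi
  have h1 : (s.assign i v).remainingᶜ = insert i s.remainingᶜ := by
    rw [PickState.assign_remaining, Finset.compl_erase]
  unfold secured
  rw [h1, welfareOn_insert hi', PickState.assign_plot_self]
  congr 2
  exact welfareOn_congr fun a ha =>
    PickState.assign_plot_of_notMem hi hv (Finset.mem_compl.1 ha)

theorem secured_assign (hφ : 0 ≤ φ) (hi : i ∈ s.remaining) (hv : v ∈ s.available) :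
    I.secured φ s + I.value i v ≤ I.secured φ (s.assign i v) := by
  rw [secured_assign_eq hi hv]
  have := mul_nonneg (mul_nonneg zero_le_two hφ)
    (sum_bond_nonneg (I := I) (S := s.remainingᶜ) (A := (s.assign i v).plot) (i := i))
  linarith

/-- If `i` takes `v`, then exchanging plots with the agent for whom `A` reserves `v` costs
the latter at most her value and her friendship. -/
theorem exists_agrees_assign (hφ : 0 ≤ φ) (hA : s.Agrees A) (hi : i ∈ s.remaining)
    (hv : v ∈ s.available) :
    ∃ B, (s.assign i v).Agrees B ∧
      I.welfareOn φ (s.remaining.erase i) A ≤ I.welfareOn φ (s.remaining.erase i) B +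
        I.value (A.symm v) v + 2 * φ * ∑ j ∈ s.remaining.erase i, I.bond A (A.symm v) j := by
  by_cases hk : A.symm v = i
  · subst hk
    refine ⟨A, by simpa using hA.assign hi, ?_⟩
    have := mul_nonneg (mul_nonneg zero_le_two hφ)
      (sum_bond_nonneg (I := I) (S := s.remaining.erase (A.symm v)) (A := A) (i := A.symm v))
    linarith [I.value_nonneg (A.symm v) v]
  · refine ⟨_, hA.assign_swap hi hv, ?_⟩
    have := welfareOn_move (I := I) (A := A) (k := A.symm v)
      (B := A.trans (Equiv.swap (A i) v)) hφ
      (Finset.mem_erase.2 ⟨hk, hA.symm_mem hv⟩) (fun a ha hak => ?_)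
    · rwa [Equiv.apply_symm_apply] at this
    · rw [Equiv.trans_apply, Equiv.swap_apply_of_ne_of_ne]
      · exact fun e => Finset.ne_of_mem_erase ha (A.injective e)
      · rintro rfl
        simp at hak

theorem exists_agrees_assign_of_le (hφ : 0 ≤ φ) (hf : I.AtMostOneFriend) (hA : s.Agrees A)
    (hi : i ∈ s.remaining) (hv : v ∈ s.available) :
    ∃ B, (s.assign i v).Agrees B ∧
      I.welfareOn φ (s.remaining.erase i) A ≤
        I.welfareOn φ (s.remaining.erase i) B + 1 + 2 * φ := by
  obtain ⟨B, hB, h⟩ := exists_agrees_assign (I := I) hφ hA hi hv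
  refine ⟨B, hB, h.trans ?_⟩
  have := mul_le_mul_of_nonneg_left (sum_bond_le_one (A := A) (i := A.symm v)
    (S := s.remaining.erase i) hf) (mul_nonneg zero_le_two hφ)
  linarith [I.value_le_one (A.symm v) v]

/-- A friendless agent takes a plot that is worth `1` to her. -/
theorem residual_assign_friendless (hφ : 0 ≤ φ) (hf : I.AtMostOneFriend)
    (hi : i ∈ s.remaining) (hv : v ∈ s.available) (hn : ∀ j, ¬ I.friends.Adj i j) :
    I.residual φ s ≤ I.residual φ (s.assign i v) + (2 * φ + 2) := by
  obtain ⟨A, hA, hR⟩ := I.exists_residual φ s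
  obtain ⟨B, hB, h⟩ := exists_agrees_assign_of_le hφ hf hA hi hv
  have h1 := welfareOn_erase (I := I) (φ := φ) (A := A) hi
  rw [sum_bond_eq_zero fun j _ => hn j] at h1
  have h2 := le_residual (I := I) (φ := φ) hB
  rw [PickState.assign_remaining] at h2
  -- The loss is 1 for the plot of `i` in `A` and 1 + 2φ for the displaced agent.
  linarith [I.value_le_one i (A i)]

/-- If two pairs of friends, each with adjacent plots, exchange their plots, then at most the plot
values are lost. -/
theorem exists_exchange (hf : I.AtMostOneFriend) (hA : s.Agrees A)
    (hi : i ∈ s.remaining) (hj : j ∈ s.remaining) (hk : k ∈ s.remaining) (hl : l ∈ s.remaining)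
    (hij : I.friends.Adj i j) (hkl : I.friends.Adj k l) (hki : k ≠ i) (hkj : k ≠ j)
    (hbij : I.plots.Adj (A i) (A j)) (hbkl : I.plots.Adj (A k) (A l)) :
    ∃ B, s.Agrees B ∧ B i = A k ∧ I.welfareOn φ s.remaining A ≤
      I.welfareOn φ ((s.remaining.erase i).erase j) B + I.value i (A i) + 3 + 2 * φ := by
  have hli : l ≠ i := by
    rintro rfl
    exact hkj (hf _ _ _ hkl.symm hij)
  have hlj : l ≠ j := by
    rintro rfl
    exact hki (hf _ _ _ hkl.symm hij.symm)
  have hji := hij.ne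
  have hlk := hkl.ne
  set B : N ≃ V := ((Equiv.swap i k).trans (Equiv.swap j l)).trans A with hB
  have hBi : B i = A k := by
    simp [hB, Equiv.swap_apply_of_ne_of_ne hkj hlk]
  have hBk : B k = A i := by
    simp [hB, Equiv.swap_apply_of_ne_of_ne hji hli.symm]
  have hBl : B l = A j := by
    simp [hB, Equiv.swap_apply_of_ne_of_ne hli hlk.symm]
  have hBo : ∀ a, a ≠ i → a ≠ j → a ≠ k → a ≠ l → B a = A a := by
    intro a h1 h2 h3 h4
    simp [hB, Equiv.swap_apply_of_ne_of_ne h1 h3, Equiv.swap_apply_of_ne_of_ne h2 h4]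
  refine ⟨B, fun a ha => ?_, hBi, ?_⟩
  · rw [hBo a, hA a ha] <;> rintro rfl <;> exact ha ‹_›
  set S := s.remaining
  set T := (((S.erase i).erase j).erase k).erase l
  have mj : j ∈ S.erase i := by simp [hji.symm, hj]
  have mk : k ∈ (S.erase i).erase j := by simp [hki, hkj, hk]
  have ml : l ∈ ((S.erase i).erase j).erase k := by simp [hli, hlj, hlk.symm, hl]
  have e1 := welfareOn_erase (I := I) (φ := φ) (A := A) hi
  have e2 := welfareOn_erase (I := I) (φ := φ) (A := A) mj
  have e3 := welfareOn_erase (I := I) (φ := φ) (A := A) mk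
  have e4 := welfareOn_erase (I := I) (φ := φ) (A := A) ml
  have f3 := welfareOn_erase (I := I) (φ := φ) (A := B) mk
  have f4 := welfareOn_erase (I := I) (φ := φ) (A := B) ml
  rw [sum_bond_eq_of_adj hf hij mj] at e1
  rw [sum_bond_eq_zero_of_adj hf hij.symm (by simp)] at e2
  rw [sum_bond_eq_of_adj hf hkl ml] at e3 f3
  rw [sum_bond_eq_zero_of_adj hf hkl.symm (by simp)] at e4 f4
  -- The friendship of `k` and `l` survives on the plots that `i` and `j` gave up. The 2φ pays for
  -- the friendship of `i` and `j`, and the 3 for the values of `j`, `k` and `l`.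
  have hT : I.welfareOn φ T A = I.welfareOn φ T B := welfareOn_congr fun a ha => by
    simp only [T, Finset.mem_erase] at ha
    exact (hBo a ha.2.2.2.1 ha.2.2.1 ha.2.1 ha.1).symm
  have b1 : I.bond A i j = 1 := if_pos ⟨hij, hbij⟩
  have b2 : I.bond A k l = 1 := if_pos ⟨hkl, hbkl⟩
  have b3 : I.bond B k l = 1 := if_pos ⟨hkl, by rwa [hBk, hBl]⟩
  rw [b1] at e1
  rw [b2] at e3
  rw [b3] at f3
  linarith [I.value_le_one j (A j), I.value_le_one k (A k), I.value_le_one l (A l),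
    I.value_nonneg k (B k), I.value_nonneg l (B l)]

/-- A pair of friends takes the plots `v` and `w`. -/
theorem residual_assign_pair (hφ : 0 ≤ φ) (hf : I.AtMostOneFriend)
    (hi : i ∈ s.remaining) (hj : j ∈ s.remaining) (hij : I.friends.Adj i j)
    (hv : v ∈ s.available) (hw : w ∈ (s.assign i v).available)
    (hbest : ∀ x ∈ s.available, I.NonSingleton s x → I.value i x ≤ I.value i v) :
    I.residual φ s ≤ I.residual φ ((s.assign i v).assign j w) + I.value i v + (4 * φ + 4) := by
  obtain ⟨A, hA, hR⟩ := I.exists_residual φ s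
  have mj : j ∈ s.remaining.erase i := by simp [hij.ne.symm, hj]
  -- The pick of `j` is charged crudely: whoever held `w` loses her value and her friendship.
  have second : ∀ B, (s.assign i v).Agrees B →
      I.welfareOn φ ((s.remaining.erase i).erase j) B ≤
        I.residual φ ((s.assign i v).assign j w) + 1 + 2 * φ := by
    intro B hB
    obtain ⟨C, hC, h⟩ := exists_agrees_assign_of_le (i := j) hφ hf hB (by simpa using mj) hw
    have := le_residual (I := I) (φ := φ) hC
    rw [PickState.assign_remaining, PickState.assign_remaining] at this
    rw [PickState.assign_remaining] at h
    linarith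
  have eB : ∀ B : N ≃ V, I.welfareOn φ (s.remaining.erase i) B ≤
      I.welfareOn φ ((s.remaining.erase i).erase j) B + 1 := by
    intro B
    have e2 := welfareOn_erase (I := I) (φ := φ) (A := B) mj
    rw [sum_bond_eq_zero_of_adj hf hij.symm (by simp)] at e2
    linarith [I.value_le_one j (B j)]
  have e1 := welfareOn_erase (I := I) (φ := φ) (A := A) hi
  rw [sum_bond_eq_of_adj hf hij mj] at e1
  have hAi := hA.mem_available.2 hi
  have hAj := hA.mem_available.2 hj
  by_cases hb : I.plots.Adj (A i) (A j)
  -- The plot of `i` in `A` has the available neighbour `A j`, so its value is bounded by that of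
  -- `v`.
  · have hval := hbest _ hAi ⟨_, hAj, hb⟩
    have b1 : I.bond A i j = 1 := if_pos ⟨hij, hb⟩
    rw [b1] at e1
    -- Charging a third friendship here would cost 6φ. If the displaced agent sits next to her
    -- friend, the two pairs trade plots instead, so that her friendship is kept; otherwise she has
    -- none to lose.
    by_cases hk : ∃ l ∈ s.remaining.erase i, I.friends.Adj (A.symm v) l ∧ I.plots.Adj v (A l)
    · obtain ⟨l, hl, hkl, hvl⟩ := hk
      have hl' := Finset.mem_of_mem_erase hl
      by_cases hki : A.symm v = i
      · have hAv : A i = v := by rw [← hki, Equiv.apply_symm_apply]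
        have := second A (hAv ▸ hA.assign hi)
        linarith [eB A]
      have hkj : A.symm v ≠ j := by
        intro e
        rw [e] at hkl
        exact Finset.ne_of_mem_erase hl (hf _ _ _ hkl hij.symm)
      obtain ⟨B, hB, hBi, h⟩ := exists_exchange (I := I) (φ := φ) hf hA hi hj (hA.symm_mem hv) hl'
        hij hkl hki hkj hb (by simpa using hvl)
      have hB' := hB.assign hi
      rw [hBi, Equiv.apply_symm_apply] at hB'
      linarith [second B hB']
    · obtain ⟨B, hB, h⟩ := exists_agrees_assign (I := I) hφ hA hi hv
      have hz : ∑ x ∈ s.remaining.erase i, I.bond A (A.symm v) x = 0 :=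
        Finset.sum_eq_zero fun x hx => if_neg fun h' => hk ⟨x, hx, h'.1, by simpa using h'.2⟩
      rw [hz] at h
      linarith [second B hB, eB B, I.value_le_one (A.symm v) v]
  · have b1 : I.bond A i j = 0 := if_neg fun h => hb h.2
    rw [b1] at e1
    obtain ⟨B, hB, h⟩ := exists_agrees_assign_of_le hφ hf hA hi hv
    -- In `A` the pair has no friendship to lose, so both displaced agents may be charged in full.
    linarith [second B hB, eB B, I.value_le_one i (A i), I.value_nonneg i v]

end LandInstance

namespace PMF

/-! ### Expectations as extended nonnegative sums, which need no summability conditions. -/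

variable {α β : Type*} {p : PMF α} {f : α → ℝ}

/-- The expectation of a (nonnegative) function. -/
noncomputable def expect (p : PMF α) (f : α → ℝ) : ENNReal := ∑' a, p a * ENNReal.ofReal (f a)

theorem expect_mono {g : α → ℝ} (h : ∀ a ∈ p.support, f a ≤ g a) : p.expect f ≤ p.expect g := by
  refine ENNReal.tsum_le_tsum fun a => ?_
  by_cases ha : p a = 0
  · simp [ha]
  · gcongr
    exact h a ((p.mem_support_iff a).2 ha)

theorem expect_const (c : ℝ) : p.expect (fun _ => c) = ENNReal.ofReal c := by
  rw [expect, ENNReal.tsum_mul_right, p.tsum_coe, one_mul]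

theorem le_expect {c : ℝ} (h : ∀ a ∈ p.support, c ≤ f a) : ENNReal.ofReal c ≤ p.expect f := by
  rw [← p.expect_const c]
  exact expect_mono h

theorem expect_pure (a : α) : (PMF.pure a).expect f = ENNReal.ofReal (f a) := by
  classical
  rw [expect, tsum_eq_single a]
  · simp
  · intro b hb
    simp [PMF.pure_apply, hb]

theorem expect_bind (g : β → PMF α) (q : PMF β) :
    (q.bind g).expect f = ∑' b, q b * (g b).expect f := by
  simp only [expect, PMF.bind_apply, ← ENNReal.tsum_mul_right, ← ENNReal.tsum_mul_left]
  rw [ENNReal.tsum_comm]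
  simp only [mul_assoc]

theorem expect_map (g : β → α) (q : PMF β) : (q.map g).expect f = q.expect (f ∘ g) := by
  rw [← PMF.bind_pure_comp, expect_bind]
  exact tsum_congr fun b => by rw [Function.comp_apply, expect_pure, Function.comp_apply]

theorem expect_le_expect_bind {g : β → PMF α} {q : PMF β} {h : β → ℝ}
    (hg : ∀ b ∈ q.support, ENNReal.ofReal (h b) ≤ (g b).expect f) :
    q.expect h ≤ (q.bind g).expect f := by
  rw [expect_bind]
  refine ENNReal.tsum_le_tsum fun b => ?_
  by_cases hb : q b = 0
  · simp [hb]
  · gcongr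
    exact hg b ((q.mem_support_iff b).2 hb)

/-- Truncating negative values to 0 only raises the right side, by subadditivity of
`ENNReal.ofReal`, so `f` need not be nonnegative. -/
theorem le_expect_of_uniform {T : Finset α} (hp : ∀ a ∈ T, p a = (T.card : ENNReal)⁻¹)
    (hT : T.Nonempty) : ENNReal.ofReal ((∑ a ∈ T, f a) / T.card) ≤ p.expect f := by
  have hc : (0 : ℝ) < T.card := Nat.cast_pos.2 hT.card_pos
  calc ENNReal.ofReal ((∑ a ∈ T, f a) / T.card)
      = (T.card : ENNReal)⁻¹ * ENNReal.ofReal (∑ a ∈ T, f a) := by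
        rw [ENNReal.ofReal_div_of_pos hc, ENNReal.ofReal_natCast, div_eq_mul_inv, mul_comm]
    _ ≤ (T.card : ENNReal)⁻¹ * ∑ a ∈ T, ENNReal.ofReal (f a) := by
        gcongr
        exact Finset.le_sum_of_subadditive _ ENNReal.ofReal_zero.le
          (fun _ _ => ENNReal.ofReal_add_le) _ _
    _ = ∑ a ∈ T, p a * ENNReal.ofReal (f a) := by
        rw [Finset.mul_sum]
        exact Finset.sum_congr rfl fun a ha => by rw [hp a ha]
    _ ≤ p.expect f := ENNReal.sum_le_tsum _

end PMF

namespace LandInstance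

open scoped Classical

/-! ### Outcomes of a turn, the invariant, and the phase with adjacent available plots. -/

variable {N V : Type*} [Fintype N] [Fintype V]

/-- No two available plots are adjacent. -/
def Edgeless (I : LandInstance N V) (s : PickState N V) : Prop :=
  ∀ v ∈ s.available, ∀ w ∈ s.available, ¬ I.plots.Adj v w

/-- No remaining agent can still become a neighbour of a friend who has picked, and such agents
exist only if no two available plots are adjacent. -/
def Settled (I : LandInstance N V) (s : PickState N V) : Prop :=
  ∀ i ∈ s.remaining, ∀ j ∉ s.remaining, I.friends.Adj i j →
    I.Edgeless s ∧ ∀ w ∈ s.available, ¬ I.plots.Adj w (s.plot j)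

/-- Some available plot is valuable to `i`. -/
def Values (I : LandInstance N V) (s : PickState N V) (i : N) : Prop :=
  ∃ v ∈ s.available, I.value i v ≠ 0

/-- The secured welfare with weight `2 * φ + 2`, plus the residual welfare with weight `θ`. -/
noncomputable def potential (I : LandInstance N V) (φ θ : ℝ) (s : PickState N V) : ℝ :=
  (2 * φ + 2) * I.secured φ s + θ * I.residual φ s

variable {I : LandInstance N V} {φ θ : ℝ} {τ : TieBreaking N V} {s s' : PickState N V}
  {A : N ≃ V} {i j : N} {v w : V}

theorem Edgeless.assign (h : I.Edgeless s) (hi : i ∈ s.remaining) (hv : v ∈ s.available) :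
    I.Edgeless (s.assign i v) := fun x hx y hy =>
  h x ((PickState.mem_assign_available hi hv).1 hx).1 y
    ((PickState.mem_assign_available hi hv).1 hy).1

theorem Settled.assign (hs : I.Settled s) (h : I.Edgeless s) (hi : i ∈ s.remaining)
    (hv : v ∈ s.available) : I.Settled (s.assign i v) := by
  intro a ha b hb hab
  refine ⟨h.assign hi hv, fun w hw => ?_⟩
  have hw' := ((PickState.mem_assign_available hi hv).1 hw).1
  rcases eq_or_ne b i with rfl | hbi
  · rw [PickState.assign_plot_self]
    exact h w hw' v hv
  · have hb' : b ∉ s.remaining := by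
      intro h'
      exact hb (by simp [hbi, h'])
    rw [PickState.assign_plot_of_notMem hi hv hb']
    exact (hs a (Finset.mem_of_mem_erase ha) b hb' hab).2 w hw'

theorem Settled.mem_remaining (hs : I.Settled s) (h : ¬ I.Edgeless s) (hi : i ∈ s.remaining)
    (hij : I.friends.Adj i j) : j ∈ s.remaining := by
  by_contra hj
  exact h (hs i hi j hj hij).1

/-- A remaining friend cannot be placed on an adjacent plot, and by `Settled` a friend who has
picked has no available neighbour; only the plot value counts. -/
theorem pickUtility_of_edgeless (hs : I.Settled s) (h : I.Edgeless s) (hi : i ∈ s.remaining)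
    (hv : v ∈ s.available) : I.pickUtility s i v = I.value i v := by
  unfold pickUtility
  rw [Finset.sum_eq_zero, add_zero]
  intro j hj
  have hij := (Finset.mem_filter.1 hj).2
  by_cases hjr : j ∈ s.remaining
  · have : ¬ I.NonSingleton s v := fun ⟨w, hw, hvw⟩ => h v hv w hw hvw
    simp [hjr, this]
  · simp [hjr, (hs i hi j hjr hij).2 v hv]

theorem pickUtility_of_friendless (hn : ∀ j, ¬ I.friends.Adj i j) :
    I.pickUtility s i v = I.value i v := by
  simp [pickUtility, hn]

theorem pickUtility_of_friend (hu : I.IsFriendshipUniform φ) (hf : I.AtMostOneFriend)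
    (hij : I.friends.Adj i j) (hj : j ∈ s.remaining) :
    I.pickUtility s i v = I.value i v + φ * (if I.NonSingleton s v then 1 else 0) := by
  unfold pickUtility
  have : (Finset.univ.filter fun k => I.friends.Adj i k) = {j} := by
    ext k
    simp only [Finset.mem_filter, Finset.mem_univ, true_and, Finset.mem_singleton]
    exact ⟨fun h => hf i k j h hij, fun h => h ▸ hij⟩
  rw [this, Finset.sum_singleton, if_pos hj, hu i j hij]

theorem bestPlots_nonempty {T : Finset V} (hT : T.Nonempty) : (I.bestPlots s i T).Nonempty := by
  obtain ⟨v, hv, h⟩ := Finset.exists_max_image T (I.pickUtility s i) hT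
  exact ⟨v, Finset.mem_filter.2 ⟨hv, h⟩⟩

theorem mem_bestPlots {T : Finset V} :
    v ∈ I.bestPlots s i T ↔ v ∈ T ∧ ∀ w ∈ T, I.pickUtility s i w ≤ I.pickUtility s i v :=
  Finset.mem_filter

theorem mem_bestPlots_of_mem_support {T : Finset V} (hT : T.Nonempty)
    (hv : v ∈ (τ.choose s i (I.bestPlots s i T)).support) : v ∈ I.bestPlots s i T :=
  τ.support_choose s i _ (bestPlots_nonempty hT) v hv

theorem exists_of_mem_support_pick {T : Finset V} (hT : T.Nonempty)
    (h : s' ∈ (I.pick τ s i T).support) : ∃ v ∈ T, s' = s.assign i v := by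
  rw [pick, PMF.mem_support_map_iff] at h
  obtain ⟨v, hv, rfl⟩ := h
  exact ⟨v, (mem_bestPlots.1 (mem_bestPlots_of_mem_support hT hv)).1, rfl⟩

/-- Of a declared friend only the admissibility of her plot is recorded: the arguments valid for
every outcome do not need her pick to be optimal. -/
theorem exists_of_mem_support_turn (hi : i ∈ s.remaining)
    (h : s' ∈ (I.turn τ s i).support) :
    ∃ v ∈ I.bestPlots s i s.available,
      ((¬ ∃ j ∈ s.remaining, I.friends.Adj i j) ∧ s' = s.assign i v) ∨
      ∃ j ∈ s.remaining, I.friends.Adj i j ∧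
        ((I.NonSingleton s v ∧ ∃ w ∈ (s.assign i v).available, I.plots.Adj v w ∧
          s' = (s.assign i v).assign j w) ∨
        (¬ I.NonSingleton s v ∧ (s' = s.assign i v ∨
          ∃ w ∈ (s.assign i v).available, s' = (s.assign i v).assign j w))) := by
  rw [turn, PMF.mem_support_bind_iff] at h
  obtain ⟨v, hv, h⟩ := h
  have hb := mem_bestPlots_of_mem_support (PickState.available_nonempty hi) hv
  have hva := (mem_bestPlots.1 hb).1
  refine ⟨v, hb, ?_⟩
  split_ifs at h with h1 h2 h3
  · right
    refine ⟨h1.choose, h1.choose_spec.1, h1.choose_spec.2, Or.inl ⟨h2, ?_⟩⟩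
    obtain ⟨x, hx, hvx⟩ := h2
    obtain ⟨w, hw, rfl⟩ := exists_of_mem_support_pick
      ⟨x, Finset.mem_filter.2
        ⟨(PickState.mem_assign_available hi hva).2 ⟨hx, hvx.ne.symm⟩, hvx⟩⟩ h
    exact ⟨w, (Finset.mem_filter.1 hw).1, (Finset.mem_filter.1 hw).2, rfl⟩
  · right
    refine ⟨h1.choose, h1.choose_spec.1, h1.choose_spec.2, Or.inr ⟨h2, Or.inr ?_⟩⟩
    have hj : h1.choose ∈ (s.assign i v).remaining :=
      Finset.mem_erase.2 ⟨h1.choose_spec.2.ne.symm, h1.choose_spec.1⟩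
    exact exists_of_mem_support_pick (PickState.available_nonempty hj) h
  · right
    refine ⟨h1.choose, h1.choose_spec.1, h1.choose_spec.2, Or.inr ⟨h2, Or.inl ?_⟩⟩
    simpa using h
  · left
    exact ⟨h1, by simpa using h⟩

theorem card_remaining_lt_of_mem_support_turn (hi : i ∈ s.remaining)
    (h : s' ∈ (I.turn τ s i).support) : s'.remaining.card < s.remaining.card := by
  have h0 := Finset.card_erase_lt_of_mem hi
  obtain ⟨v, -, ⟨-, rfl⟩ | ⟨j, -, -, ⟨-, w, -, -, rfl⟩ | ⟨-, rfl | ⟨w, -, rfl⟩⟩⟩⟩ :=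
    exists_of_mem_support_turn hi h
  · exact h0
  · exact (Finset.card_erase_le).trans_lt h0
  · exact h0
  · exact (Finset.card_erase_le).trans_lt h0

theorem secured_le_of_mem_support_turn (hφ : 0 ≤ φ) (hi : i ∈ s.remaining)
    (h : s' ∈ (I.turn τ s i).support) : I.secured φ s ≤ I.secured φ s' := by
  obtain ⟨v, hv, h⟩ := exists_of_mem_support_turn hi h
  have hva := (mem_bestPlots.1 hv).1
  have h1 := (le_add_of_nonneg_right (I.value_nonneg i v)).trans
    (secured_assign (I := I) hφ hi hva)
  obtain ⟨-, rfl⟩ | ⟨j, hj, hij, h⟩ := h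
  · exact h1
  have hj' : j ∈ (s.assign i v).remaining := Finset.mem_erase.2 ⟨hij.ne.symm, hj⟩
  obtain ⟨-, w, hw, -, rfl⟩ | ⟨-, rfl | ⟨w, hw, rfl⟩⟩ := h
  · exact h1.trans ((le_add_of_nonneg_right (I.value_nonneg j w)).trans
      (secured_assign hφ hj' hw))
  · exact h1
  · exact h1.trans ((le_add_of_nonneg_right (I.value_nonneg j w)).trans
      (secured_assign hφ hj' hw))

/-- An agent with a remaining friend picks, if possible, a plot with adjacent available plots. -/
theorem nonSingleton_of_mem_bestPlots (hu : I.IsFriendshipUniform φ) (hf : I.AtMostOneFriend)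
    (hφ : 1 < φ) (hij : I.friends.Adj i j) (hj : j ∈ s.remaining) (h : ¬ I.Edgeless s)
    (hv : v ∈ I.bestPlots s i s.available) : I.NonSingleton s v := by
  by_contra hns
  unfold Edgeless at h
  push Not at h
  obtain ⟨x, hx, y, hy, hxy⟩ := h
  have hx' : I.NonSingleton s x := ⟨y, hy, hxy⟩
  have := (mem_bestPlots.1 hv).2 x hx
  rw [pickUtility_of_friend hu hf hij hj, pickUtility_of_friend hu hf hij hj, if_pos hx',
    if_neg hns] at this
  linarith [I.value_nonneg i x, I.value_le_one i v]

/-- While adjacent plots are available, friends leave together. Afterwards a pair may be split, but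
a plot taken then has no available neighbour. -/
theorem Settled.of_mem_support_turn (hu : I.IsFriendshipUniform φ) (hf : I.AtMostOneFriend)
    (hφ : 1 < φ) (hs : I.Settled s) (hi : i ∈ s.remaining)
    (h : s' ∈ (I.turn τ s i).support) : I.Settled s' := by
  obtain ⟨v, hv, h⟩ := exists_of_mem_support_turn hi h
  have hva := (mem_bestPlots.1 hv).1
  by_cases he : I.Edgeless s
  · have h1 := hs.assign he hi hva
    obtain ⟨-, rfl⟩ | ⟨j, hj, hij, h⟩ := h
    · exact h1
    have hj' : j ∈ (s.assign i v).remaining := Finset.mem_erase.2 ⟨hij.ne.symm, hj⟩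
    obtain ⟨-, w, hw, -, rfl⟩ | ⟨-, rfl | ⟨w, hw, rfl⟩⟩ := h
    · exact h1.assign (he.assign hi hva) hj' hw
    · exact h1
    · exact h1.assign (he.assign hi hva) hj' hw
  · obtain ⟨hn, rfl⟩ | ⟨j, hj, hij, h⟩ := h
    · intro a ha b hb hab
      have ha' := Finset.mem_of_mem_erase ha
      have hb' := hs.mem_remaining he ha' hab
      rcases eq_or_ne b i with rfl | hbi
      · exact absurd ⟨a, ha', hab.symm⟩ hn
      · exact absurd (Finset.mem_erase.2 ⟨hbi, hb'⟩) hb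
    · obtain ⟨-, w, hw, -, rfl⟩ | ⟨hns, -⟩ := h
      · intro a ha b hb hab
        simp only [PickState.assign_remaining, Finset.mem_erase] at ha hb
        have hb' := hs.mem_remaining he ha.2.2 hab
        rcases eq_or_ne b i with rfl | hbi
        · exact absurd (hf _ _ _ hab.symm hij) ha.1
        rcases eq_or_ne b j with rfl | hbj
        · exact absurd (hf _ _ _ hab.symm hij.symm) ha.2.1
        · exact absurd ⟨hbj, hbi, hb'⟩ hb
      · exact absurd (nonSingleton_of_mem_bestPlots hu hf hφ hij hj he hv) hns

/-- As long as there are adjacent available plots, no turn of an active agent decreases the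
potential. -/
theorem potential_le_of_mem_support_turn (hbin : I.IsBinary) (hu : I.IsFriendshipUniform φ)
    (hf : I.AtMostOneFriend) (hφ : 1 < φ) (hs : I.Settled s) (he : ¬ I.Edgeless s)
    (hi : i ∈ s.remaining) (ha : (∃ j, I.friends.Adj i j) ∨ I.Values s i)
    (h : s' ∈ (I.turn τ s i).support) : I.potential φ 1 s ≤ I.potential φ 1 s' := by
  have hφ0 : 0 ≤ φ := by linarith
  obtain ⟨v, hv, h⟩ := exists_of_mem_support_turn hi h
  have hva := (mem_bestPlots.1 hv).1
  have hs1 := secured_assign (I := I) hφ0 hi hva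
  unfold potential
  obtain ⟨hn, rfl⟩ | ⟨j, hj, hij, h⟩ := h
  · have hn' : ∀ j, ¬ I.friends.Adj i j := fun j hij => hn ⟨j, hs.mem_remaining he hi hij, hij⟩
    have hval : I.value i v = 1 := by
      obtain ⟨j, hij⟩ | ⟨x, hx, hx0⟩ := ha
      · exact absurd hij (hn' j)
      · have := (mem_bestPlots.1 hv).2 x hx
        rw [pickUtility_of_friendless hn', pickUtility_of_friendless hn',
          (hbin i x).resolve_left hx0] at this
        linarith [I.value_le_one i v]
    have := residual_assign_friendless (v := v) hφ0 hf hi hva hn'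
    rw [hval] at hs1
    -- Gain and loss are both 2φ+2; this case dictates the weight of `secured` in the potential.
    nlinarith
  · have hns := nonSingleton_of_mem_bestPlots hu hf hφ hij hj he hv
    obtain ⟨-, w, hw, hvw, rfl⟩ | ⟨hns', -⟩ := h
    swap
    · exact absurd hns hns'
    have hj' : j ∈ (s.assign i v).remaining := Finset.mem_erase.2 ⟨hij.ne.symm, hj⟩
    have hi' : i ∉ (s.assign i v).remaining := Finset.notMem_erase _ _
    have hs2 := secured_assign_eq (I := I) (φ := φ) hj' hw
    rw [sum_bond_eq_of_adj hf hij.symm (Finset.mem_compl.2 hi')] at hs2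
    have hb : I.bond ((s.assign i v).assign j w).plot j i = 1 := by
      refine if_pos ⟨hij.symm, ?_⟩
      rw [PickState.assign_plot_self, PickState.assign_plot_of_notMem hj' hw hi',
        PickState.assign_plot_self]
      exact hvw.symm
    rw [hb] at hs2
    have hr := residual_assign_pair (φ := φ) hφ0 hf hi hj hij hva hw (fun x hx hxn => ?_)
    · have h1 : I.secured φ s + I.value i v + 2 * φ ≤
          I.secured φ ((s.assign i v).assign j w) := by linarith [I.value_nonneg j w]
      have h2 := mul_le_mul_of_nonneg_left h1 (show 0 ≤ 2 * φ + 2 by linarith)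
      -- After the terms in `I.value i v`, it remains that 2φ(2φ+2) ≥ 4φ+4, which is φ² ≥ 1.
      nlinarith [mul_nonneg hφ0 (I.value_nonneg i v), I.value_nonneg i v]
    · have := (mem_bestPlots.1 hv).2 x hx
      rw [pickUtility_of_friend hu hf hij hj, pickUtility_of_friend hu hf hij hj, if_pos hxn,
        if_pos hns] at this
      linarith

end LandInstance

namespace LandInstance

open scoped Classical

/-! ### The phase without adjacent available plots. -/

variable {N V : Type*} [Fintype N] [Fintype V]

variable {I : LandInstance N V} {φ θ : ℝ} {τ : TieBreaking N V} {s s' : PickState N V}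
  {A : N ≃ V} {i j : N} {v w : V}

theorem welfareOn_of_edgeless (h : I.Edgeless s) (hA : s.Agrees A) :
    I.welfareOn φ s.remaining A = ∑ a ∈ s.remaining, I.value a (A a) := by
  unfold welfareOn
  rw [Finset.sum_eq_zero fun a ha => Finset.sum_eq_zero fun b hb => ?_, mul_zero, add_zero]
  exact if_neg fun h' => h _ (hA.mem_available.2 ha) _ (hA.mem_available.2 hb) h'.2

theorem residual_le_card_values (h : I.Edgeless s) :
    I.residual φ s ≤ (s.remaining.filter (I.Values s)).card := by
  obtain ⟨A, hA, hR⟩ := I.exists_residual φ s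
  rw [← hR, welfareOn_of_edgeless h hA, Finset.card_filter, Nat.cast_sum]
  refine Finset.sum_le_sum fun a ha => ?_
  split_ifs with hv
  · simpa using I.value_le_one a (A a)
  · have : I.value a (A a) = 0 := by
      by_contra h0
      exact hv ⟨_, hA.mem_available.2 ha, h0⟩
    simp [this]

/-- Friendships contribute nothing here, so only two plot values are at stake: that of the picker
and that of the agent she displaces. -/
theorem welfareOn_le_residual_assign_of_edgeless (hφ : 0 ≤ φ) (h : I.Edgeless s)
    (hA : s.Agrees A) (hi : i ∈ s.remaining) (hv : v ∈ s.available) :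
    I.welfareOn φ s.remaining A ≤
      I.residual φ (s.assign i v) + I.value i (A i) + I.value (A.symm v) v := by
  have hz : ∀ x ∈ s.remaining, ∀ S ⊆ s.remaining, ∑ y ∈ S, I.bond A x y = 0 :=
    fun x hx S hS => Finset.sum_eq_zero fun y hy => if_neg fun h' =>
      h _ (hA.mem_available.2 hx) _ (hA.mem_available.2 (hS hy)) h'.2
  obtain ⟨B, hB, h1⟩ := exists_agrees_assign (I := I) hφ hA hi hv
  have h2 := le_residual (I := I) (φ := φ) hB
  have h3 := welfareOn_erase (I := I) (φ := φ) (A := A) hi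
  rw [hz i hi _ (Finset.erase_subset _ _)] at h3
  rw [hz _ (hA.symm_mem hv) _ (Finset.erase_subset _ _)] at h1
  rw [PickState.assign_remaining] at h2
  linarith

theorem value_eq_one_of_edgeless (hbin : I.IsBinary) (hs : I.Settled s) (he : I.Edgeless s)
    (hi : i ∈ s.remaining) (hval : I.Values s i) (hv : v ∈ I.bestPlots s i s.available) :
    I.value i v = 1 := by
  obtain ⟨x, hx, hx0⟩ := hval
  obtain ⟨hva, hv⟩ := mem_bestPlots.1 hv
  have := hv x hx
  rw [pickUtility_of_edgeless hs he hi hx, pickUtility_of_edgeless hs he hi hva,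
    (hbin i x).resolve_left hx0] at this
  linarith [I.value_le_one i v]

/-- An agent picks a plot that is worth `1` to her while no two available plots are adjacent. -/
theorem potential_assign_of_values (hbin : I.IsBinary) (hφ : 0 ≤ φ) (hθ : 0 ≤ θ)
    (hs : I.Settled s) (he : I.Edgeless s) (hi : i ∈ s.remaining) (hval : I.Values s i)
    (hv : v ∈ I.bestPlots s i s.available) :
    (2 * φ + 2) * (I.secured φ s + 1) + θ * (I.residual φ s - 2) ≤
      I.potential φ θ (s.assign i v) := by
  have hva := (mem_bestPlots.1 hv).1
  have h1 := secured_assign (I := I) hφ hi hva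
  rw [value_eq_one_of_edgeless hbin hs he hi hval hv] at h1
  obtain ⟨A, hA, hR⟩ := I.exists_residual φ s
  have h2 := welfareOn_le_residual_assign_of_edgeless hφ he hA hi hva
  have h3 : I.residual φ s - 2 ≤ I.residual φ (s.assign i v) := by
    linarith [I.value_le_one i (A i), I.value_le_one (A.symm v) v]
  exact add_le_add (mul_le_mul_of_nonneg_left h1 (by linarith)) (mul_le_mul_of_nonneg_left h3 hθ)

/-- An agent with a friend to whom all plots are worthless picks a uniformly random plot
while no two available plots are adjacent. -/
theorem potential_choose_of_worthless (hφ : 0 ≤ φ) (hθ : 0 ≤ θ) (hτ : I.UnbiasedWhenWorthless τ)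
    (hs : I.Settled s) (he : I.Edgeless s) (hi : i ∈ s.remaining) (hval : ¬ I.Values s i)
    (hij : ∃ j, I.friends.Adj i j) :
    ENNReal.ofReal ((2 * φ + 2) * I.secured φ s +
        θ * (I.residual φ s - I.residual φ s / s.remaining.card)) ≤
      (τ.choose s i (I.bestPlots s i s.available)).expect
        fun v => I.potential φ θ (s.assign i v) := by
  have hv0 : ∀ v ∈ s.available, I.value i v = 0 := by
    intro v hv
    by_contra h
    exact hval ⟨v, hv, h⟩
  have hu0 : ∀ v ∈ s.available, I.pickUtility s i v = 0 := fun v hv => by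
    rw [pickUtility_of_edgeless hs he hi hv, hv0 v hv]
  have hb : I.bestPlots s i s.available = s.available := by
    ext v
    rw [mem_bestPlots]
    exact ⟨fun h => h.1, fun h => ⟨h, fun w hw => by rw [hu0 v h, hu0 w hw]⟩⟩
  rw [hb]
  refine le_trans (ENNReal.ofReal_le_ofReal ?_)
    (PMF.le_expect_of_uniform (hτ s i hi hij hu0) (PickState.available_nonempty hi))
  obtain ⟨A, hA, hR⟩ := I.exists_residual φ s
  have hc : (0 : ℝ) < s.remaining.card := Nat.cast_pos.2 (Finset.card_pos.2 ⟨i, hi⟩)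
  rw [PickState.card_available, le_div_iff₀ hc]
  -- Picking `v` destroys the value that an optimal `A` draws from `v`; these values add up to the
  -- residual, so a uniform pick destroys the average.
  have hsum : ∑ v ∈ s.available, I.value (A.symm v) v = I.residual φ s := by
    rw [← hR, welfareOn_of_edgeless he hA]
    refine (Finset.sum_nbij A (fun a ha => hA.mem_available.2 ha) A.injective.injOn
      (fun v hv => ⟨A.symm v, hA.symm_mem hv, by simp⟩) (fun a _ => by simp)).symm
  calc _ = ∑ v ∈ s.available, ((2 * φ + 2) * I.secured φ s +
          θ * (I.residual φ s - I.value (A.symm v) v)) := by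
        simp only [Finset.sum_add_distrib, Finset.sum_sub_distrib, Finset.sum_const, nsmul_eq_mul,
          ← Finset.mul_sum, hsum, PickState.card_available]
        field_simp
    _ ≤ _ := by
        refine Finset.sum_le_sum fun v hv => ?_
        have h1 := secured_assign (I := I) hφ hi hv
        have h2 := welfareOn_le_residual_assign_of_edgeless hφ he hA hi hv
        rw [hv0 v hv] at h1
        rw [hv0 _ (hA.mem_available.2 hi)] at h2
        exact add_le_add (mul_le_mul_of_nonneg_left (by linarith) (by linarith))
          (mul_le_mul_of_nonneg_left (by linarith) hθ)

theorem residual_le_card (he : I.Edgeless s) : I.residual φ s ≤ s.remaining.card :=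
  (residual_le_card_values he).trans (Nat.cast_le.2 (Finset.card_filter_le _ _))

/-- A single pick of an agent with a friend loses at most the average residual welfare. -/
theorem potential_pick_available (hbin : I.IsBinary) (hφ : 0 ≤ φ)
    (hτ : I.UnbiasedWhenWorthless τ)
    (hs : I.Settled s) (he : I.Edgeless s) (hi : i ∈ s.remaining)
    (hij : ∃ j, I.friends.Adj i j) :
    ENNReal.ofReal ((2 * φ + 2) * I.secured φ s +
        (1 - 1 / s.remaining.card) * I.residual φ s) ≤
      (I.pick τ s i s.available).expect (I.potential φ 1) := by
  rw [pick, PMF.expect_map]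
  by_cases hval : I.Values s i
  · refine PMF.le_expect fun v hv => ?_
    have h := potential_assign_of_values hbin hφ zero_le_one hs he hi hval
      (mem_bestPlots_of_mem_support (PickState.available_nonempty hi) hv)
    refine le_trans ?_ h
    have : 0 ≤ 1 / (s.remaining.card : ℝ) * I.residual φ s :=
      mul_nonneg (by positivity) (residual_nonneg hφ)
    nlinarith
  · refine le_trans (ENNReal.ofReal_le_ofReal (le_of_eq ?_))
      (potential_choose_of_worthless hφ zero_le_one hτ hs he hi hval hij)
    ring

/-- The whole turn of an agent is, up to a factor `θ`, as good as her own pick. -/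
theorem exists_expect_choose_le_turn (hbin : I.IsBinary) (hφ : 0 ≤ φ)
    (hτ : I.UnbiasedWhenWorthless τ)
    (hs : I.Settled s) (he : I.Edgeless s) (hi : i ∈ s.remaining) :
    ∃ θ : ℝ, 0 ≤ θ ∧ θ ≤ 1 ∧ (1 - θ) * (s.remaining.card - 1) ≤ 1 ∧
      ((τ.choose s i (I.bestPlots s i s.available)).expect
        fun v => I.potential φ θ (s.assign i v)) ≤ (I.turn τ s i).expect (I.potential φ 1) := by
  by_cases hj : ∃ j ∈ s.remaining, I.friends.Adj i j
  · have hjr : hj.choose ∈ s.remaining.erase i :=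
      Finset.mem_erase.2 ⟨hj.choose_spec.2.ne.symm, hj.choose_spec.1⟩
    have hm : 1 ≤ (s.remaining.erase i).card := Finset.card_pos.2 ⟨_, hjr⟩
    have hm' : (1 : ℝ) ≤ (s.remaining.erase i).card := by exact_mod_cast hm
    have hc : (s.remaining.card : ℝ) - 1 = (s.remaining.erase i).card := by
      rw [Finset.card_erase_of_mem hi, Nat.cast_sub (Finset.card_pos.2 ⟨i, hi⟩), Nat.cast_one]
    have hle : 1 / ((s.remaining.erase i).card : ℝ) ≤ 1 := (div_le_one (by linarith)).2 hm'
    -- The factor by which a worthless uniform pick of the declared friend, one of the agents left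
    -- after `i`, shrinks the residual on average. If she is not declared or values some plot, the
    -- bound only gets better.
    refine ⟨1 - 1 / (s.remaining.erase i).card, by linarith, by
      have : 0 ≤ 1 / ((s.remaining.erase i).card : ℝ) := by positivity
      linarith, ?_, ?_⟩
    · rw [hc, sub_sub_cancel, one_div_mul_cancel (by linarith)]
    · refine PMF.expect_le_expect_bind fun v hv => ?_
      have hva := (mem_bestPlots.1
        (mem_bestPlots_of_mem_support (PickState.available_nonempty hi) hv)).1
      have hns : ¬ I.NonSingleton s v := fun ⟨w, hw, hvw⟩ => he v hva w hw hvw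
      rw [dif_pos hj, if_neg hns]
      split_ifs with hd
      · exact potential_pick_available hbin hφ hτ (hs.assign he hi hva) (he.assign hi hva) hjr
          ⟨i, hj.choose_spec.2.symm⟩
      · rw [PMF.expect_pure]
        refine ENNReal.ofReal_le_ofReal ?_
        unfold potential
        have : 0 ≤ 1 / ((s.remaining.erase i).card : ℝ) * I.residual φ (s.assign i v) :=
          mul_nonneg (by positivity) (residual_nonneg hφ)
        linarith
  · refine ⟨1, zero_le_one, le_rfl, by simp, PMF.expect_le_expect_bind fun v hv => ?_⟩
    rw [dif_neg hj, PMF.expect_pure]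

/-- The change of the potential in the turn of an agent while no two available plots
are adjacent. -/
theorem potential_turn_of_edgeless (hbin : I.IsBinary) (hφ : 0 ≤ φ)
    (hτ : I.UnbiasedWhenWorthless τ) (hs : I.Settled s) (he : I.Edgeless s)
    (hi : i ∈ s.remaining) (ha : (∃ j, I.friends.Adj i j) ∨ I.Values s i) :
    ENNReal.ofReal (I.potential φ 1 s + ((if I.Values s i then 2 * φ + I.residual φ s /
        s.remaining.card else 0) - 2 * (I.residual φ s / s.remaining.card))) ≤
      (I.turn τ s i).expect (I.potential φ 1) := by
  obtain ⟨θ, h0, h1, hθ, hle⟩ := exists_expect_choose_le_turn hbin hφ hτ hs he hi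
  refine le_trans ?_ hle
  have hc : (0 : ℝ) < s.remaining.card := Nat.cast_pos.2 (Finset.card_pos.2 ⟨i, hi⟩)
  have hc1 : (1 : ℝ) ≤ s.remaining.card := Nat.one_le_cast.2 (Finset.card_pos.2 ⟨i, hi⟩)
  have hR := residual_le_card (φ := φ) he
  have hR0 := residual_nonneg (I := I) (s := s) hφ
  set m : ℝ := (s.remaining.card : ℝ)
  set R := I.residual φ s with hRdef
  split_ifs with hval
  · refine PMF.le_expect fun v hv => le_trans ?_ (potential_assign_of_values hbin hφ h0 hs he hi
      hval (mem_bestPlots_of_mem_support (PickState.available_nonempty hi) hv))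
    -- The extra loss from a declared friend. For `R ≥ 2` it follows from `R ≤ m` and the bound `hθ`
    -- on `1 - θ`.
    have : (1 - θ) * (R - 2) ≤ R / m := by
      rcases le_total R 2 with h2 | h2
      · exact (mul_nonpos_of_nonneg_of_nonpos (by linarith) (by linarith)).trans (by positivity)
      · rw [le_div_iff₀ hc]
        have e1 : (1 - θ) * (R - 2) ≤ (1 - θ) * (m - 1) :=
          mul_le_mul_of_nonneg_left (by linarith) (by linarith)
        have e2 : (1 - θ) * (m - 1) * (R - 2) ≤ 1 * (R - 2) :=
          mul_le_mul_of_nonneg_right hθ (by linarith)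
        linarith
    unfold potential
    rw [← hRdef]
    linarith
  · refine le_trans (ENNReal.ofReal_le_ofReal ?_)
      (potential_choose_of_worthless hφ h0 hτ hs he hi hval (ha.resolve_right hval))
    -- The declared friend loses at most as much as the drawn agent did: R - R/m is (m - 1) times
    -- R/m.
    have : (1 - θ) * (R - R / m) ≤ R / m := by
      have e : R - R / m = (R / m) * (m - 1) := by field_simp
      rw [e]
      have := mul_le_mul_of_nonneg_left hθ (show 0 ≤ R / m by positivity)
      linarith
    unfold potential
    rw [← hRdef]
    linarith

/-! ### Rounds, iteration, and the comparison of initial and final potential. -/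

theorem mem_active : i ∈ I.active s ↔
    i ∈ s.remaining ∧ ((∃ j, I.friends.Adj i j) ∨ I.Values s i) :=
  Finset.mem_filter

theorem drawPool_subset : I.drawPool s ⊆ s.remaining := by
  unfold drawPool
  split_ifs
  · exact Finset.filter_subset _ _
  · exact subset_rfl

theorem residual_of_active_eq_empty (h : ¬ (I.active s).Nonempty) : I.residual φ s = 0 := by
  have h' : ∀ a ∈ s.remaining, ¬ ((∃ j, I.friends.Adj a j) ∨ I.Values s a) := fun a ha h0 =>
    h ⟨a, mem_active.2 ⟨ha, h0⟩⟩
  obtain ⟨A, hA, hR⟩ := I.exists_residual φ s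
  rw [← hR, welfareOn, Finset.sum_eq_zero, Finset.sum_eq_zero, mul_zero, add_zero]
  · exact fun a ha => sum_bond_eq_zero fun j _ hj => h' a ha (Or.inl ⟨j, hj⟩)
  · intro a ha
    by_contra h0
    exact h' a ha (Or.inr ⟨_, hA.mem_available.2 ha, h0⟩)

theorem exists_of_mem_support_round (h : s' ∈ (I.round τ s).support) :
    (∃ i ∈ I.drawPool s, s' ∈ (I.turn τ s i).support) ∨ (s.remaining = ∅ ∧ s' = s) := by
  unfold round at h
  split_ifs at h with hp
  · left
    rw [PMF.mem_support_bind_iff] at h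
    obtain ⟨i, hi, h⟩ := h
    exact ⟨i, by simpa using hi, h⟩
  · right
    refine ⟨?_, by simpa using h⟩
    unfold drawPool at hp
    split_ifs at hp with ha
    · exact absurd ha hp
    exact Finset.not_nonempty_iff_eq_empty.1 hp

/-- The expected potential does not decrease in a round. -/
theorem potential_le_expect_round (hbin : I.IsBinary) (hu : I.IsFriendshipUniform φ)
    (hf : I.AtMostOneFriend) (hφ : 1 < φ) (hτ : I.UnbiasedWhenWorthless τ) (hs : I.Settled s) :
    ENNReal.ofReal (I.potential φ 1 s) ≤ (I.round τ s).expect (I.potential φ 1) := by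
  have hφ0 : 0 ≤ φ := by linarith
  by_cases ha : (I.active s).Nonempty
  · have hpool : I.drawPool s = I.active s := if_pos ha
    by_cases he : I.Edgeless s
    · unfold round
      rw [dif_pos (by rwa [hpool])]
      set R := I.residual φ s with hRdef
      set m : ℝ := (s.remaining.card : ℝ) with hm
      set h : N → ℝ := fun i => I.potential φ 1 s +
        ((if I.Values s i then 2 * φ + R / m else 0) - 2 * (R / m)) with hh
      refine le_trans ?_ (PMF.expect_le_expect_bind (h := h) fun i hi => ?_)
      · refine le_trans (ENNReal.ofReal_le_ofReal ?_) (PMF.le_expect_of_uniform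
          (T := I.active s) (fun a ha' => ?_) ha)
        · have hp : (0 : ℝ) < (I.active s).card := Nat.cast_pos.2 ha.card_pos
          have hpm : ((I.active s).card : ℝ) ≤ m :=
            Nat.cast_le.2 (Finset.card_le_card (Finset.filter_subset _ _))
          have hq : (I.active s).filter (I.Values s) = s.remaining.filter (I.Values s) := by
            ext a
            simp only [Finset.mem_filter, mem_active]
            tauto
          have hRq := residual_le_card_values (φ := φ) he
          rw [← hq, ← hRdef] at hRq
          have hR0 : 0 ≤ R := residual_nonneg hφ0
          rw [le_div_iff₀ hp, hh, Finset.sum_add_distrib, Finset.sum_const, nsmul_eq_mul,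
            Finset.sum_sub_distrib, Finset.sum_const, nsmul_eq_mul, ← Finset.sum_filter,
            Finset.sum_const, nsmul_eq_mul]
          have hm0 : 0 < m := hp.trans_le hpm
          -- Summed over the active agents, the losses are at most 2R. The gains are at least 2 for
          -- each agent who values some plot, by φ > 1, and there are at least R such agents.
          have e1 : ((I.active s).card : ℝ) * (R / m) ≤ R := by
            have := mul_le_mul_of_nonneg_right hpm (show 0 ≤ R / m by positivity)
            rwa [mul_div_cancel₀ _ hm0.ne'] at this
          have e2 : (((I.active s).filter (I.Values s)).card : ℝ) * 2 ≤
              ((I.active s).filter (I.Values s)).card * (2 * φ + R / m) :=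
            mul_le_mul_of_nonneg_left (by have : 0 ≤ R / m := by positivity
                                          linarith) (Nat.cast_nonneg _)
          linarith
        · rw [PMF.uniformOfFinset_apply_of_mem, hpool]
          rwa [hpool]
      · have hi' : i ∈ I.active s := by simpa [hpool] using hi
        exact potential_turn_of_edgeless hbin hφ0 hτ hs he (mem_active.1 hi').1
          (mem_active.1 hi').2
    · refine PMF.le_expect fun s' h => ?_
      obtain ⟨i, hi, h⟩ | ⟨-, rfl⟩ := exists_of_mem_support_round h
      · rw [hpool, mem_active] at hi
        exact potential_le_of_mem_support_turn hbin hu hf hφ hs he hi.1 hi.2 h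
      · exact le_rfl
  · refine PMF.le_expect fun s' h => ?_
    obtain ⟨i, hi, h⟩ | ⟨-, rfl⟩ := exists_of_mem_support_round h
    · unfold potential
      rw [residual_of_active_eq_empty ha]
      have := mul_le_mul_of_nonneg_left
        (secured_le_of_mem_support_turn (I := I) hφ0 (drawPool_subset hi) h)
        (show 0 ≤ 2 * φ + 2 by linarith)
      linarith [residual_nonneg (I := I) (s := s') hφ0]
    · exact le_rfl

/-- Every round with remaining agents removes at least one, and later rounds do nothing, so `k`
rounds exhaust at most `k` agents; then the residual is 0 and all welfare is secured. -/
theorem potential_le_expect_run (hbin : I.IsBinary) (hu : I.IsFriendshipUniform φ)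
    (hf : I.AtMostOneFriend) (hφ : 1 < φ) (hτ : I.UnbiasedWhenWorthless τ) (k : ℕ) :
    ∀ s : PickState N V, I.Settled s → s.remaining.card ≤ k →
      ENNReal.ofReal (I.potential φ 1 s) ≤
        (I.run τ k s).expect fun t => (2 * φ + 2) * I.socialWelfare t.plot := by
  induction k with
  | zero =>
    intro s _ hk
    have hr : s.remaining = ∅ := by simpa using hk
    rw [run, PMF.expect_pure]
    refine le_of_eq ?_
    obtain ⟨A, -, hR⟩ := I.exists_residual φ s
    rw [potential, ← hR, secured, socialWelfare_eq hu, hr]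
    simp [welfareOn]
  | succ k ih =>
    intro s hs hk
    refine (potential_le_expect_round hbin hu hf hφ hτ hs).trans
      (PMF.expect_le_expect_bind fun s' h => ?_)
    obtain ⟨i, hi, h⟩ | ⟨hr, rfl⟩ := exists_of_mem_support_round h
    · have hi' := drawPool_subset hi
      have := card_remaining_lt_of_mem_support_turn hi' h
      exact ih s' (hs.of_mem_support_turn hu hf hφ hi' h) (by omega)
    · exact ih s' hs (by simp [hr])

theorem socialWelfare_nonneg (hφ : 0 ≤ φ) (hu : I.IsFriendshipUniform φ) :
    0 ≤ I.socialWelfare A := by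
  rw [socialWelfare_eq hu]
  exact welfareOn_nonneg hφ

theorem expect_socialWelfare (hφ : 0 ≤ φ) (hu : I.IsFriendshipUniform φ) {c : ℝ}
    (hc : 0 ≤ c) (P : PMF (N ≃ V)) :
    P.expect (fun A => c * I.socialWelfare A) = ENNReal.ofReal (c * I.expectedWelfare P) := by
  rw [PMF.expect, tsum_fintype, expectedWelfare, Finset.mul_sum, ENNReal.ofReal_sum_of_nonneg]
  · refine Finset.sum_congr (by congr!) fun A _ => ?_
    rw [mul_left_comm, ENNReal.ofReal_mul ENNReal.toReal_nonneg,
      ENNReal.ofReal_toReal (P.apply_ne_top A)]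
  · exact fun A _ => mul_nonneg hc (mul_nonneg ENNReal.toReal_nonneg (socialWelfare_nonneg hφ hu))

theorem potential_initialState (hu : I.IsFriendshipUniform φ) :
    I.potential φ 1 I.initialState = I.opt := by
  have h1 : I.secured φ I.initialState = 0 := by simp [secured, initialState, welfareOn]
  have h2 : I.residual φ I.initialState = I.opt := by
    unfold residual opt
    refine (Equiv.subtypeUnivEquiv fun A a ha => ?_).iSup_congr fun A => ?_
    · exact absurd (Finset.mem_univ a) ha
    · rw [socialWelfare_eq hu]
      rfl
  rw [potential, h1, h2]
  ring

end LandInstance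

theorem theorem5p2 {N V : Type*} [Fintype N] [Fintype V] (I : LandInstance N V) (φ : ℝ)
    (hbinary : I.IsBinary) (huniform : I.IsFriendshipUniform φ) (hfriend : I.AtMostOneFriend)
    (hφ : 1 < φ) (τ : TieBreaking N V) (hτ : I.UnbiasedWhenWorthless τ) :
    I.expectedWelfare (I.onCARSDStar τ) ≥ 1 / (2 * φ + 2) * I.opt := by
  have hφ0 : 0 ≤ φ := by linarith
  have h := LandInstance.potential_le_expect_run hbinary huniform hfriend hφ hτ (Fintype.card N)
    I.initialState (fun _ _ j hj => absurd (Finset.mem_univ j) hj) (Finset.card_le_univ _)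
  have h1 := LandInstance.expect_socialWelfare hφ0 huniform
    (show 0 ≤ 2 * φ + 2 by linarith) (I.onCARSDStar τ)
  rw [LandInstance.onCARSDStar, PMF.expect_map] at h1
  rw [LandInstance.potential_initialState huniform] at h
  have h2 : _ ≤ ENNReal.ofReal (_ * I.expectedWelfare (I.onCARSDStar τ)) := h.trans h1.le
  have h3 : 0 ≤ I.expectedWelfare (I.onCARSDStar τ) :=
    Finset.sum_nonneg fun A _ => mul_nonneg ENNReal.toReal_nonneg
      (LandInstance.socialWelfare_nonneg hφ0 huniform)
  rw [ENNReal.ofReal_le_ofReal_iff (mul_nonneg (by linarith) h3)] at h2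
  rw [ge_iff_le, one_div_mul_eq_div, div_le_iff₀ (by linarith)]
  linarith
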